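/- For an irrational real number $\xi$ let $D(\xi)=\{m+n\xi : m,n\in\mathbb Z\}\subseteq\mathbb R$, with the addition and the order inherited from $\mathbb R$. Let the language of ordered groups be $\{+,-,0,\le\}$ and the language of lattice-ordered groups ($\ell$-groups) be $\{+,-,0,\vee,\wedge\}$; both are countable. (a) For every irrational $\xi$, $D(\xi)=\mathbb Z\oplus\mathbb Z\xi$ (each element is $m+n\xi$ for exactly one pair of integers $(m,n)$), the group $D(\xi)$ is generated by the two elements $1$ and $\xi$, it is dense in $\mathbb R$, and it is a densely and totally ordered abelian group. (b) For all irrational $\xi$ and $\eta$, $D(\xi)$ and $D(\eta)$ are elementarily equivalent, both in the language of ordered groups and in the language of $\ell$-groups. (c) Up to isomorphism, the $D(\xi)$ form an uncountable family: there is an uncountable set $X$ of irrational numbers such that for distinct $\xi,\eta\in X$ the groups $D(\xi)$ and $D(\eta)$ are isomorphic neither as ordered groups nor as $\ell$-groups, while for each irrational $\eta$ the ordered group $D(\eta)$ is isomorphic to $D(\xi)$ for some $\xi\in X$. (d) Consequently, it is not true that any two finitely generated abelian $\ell$-groups which satisfy the same first-order sentences in the language of $\ell$-groups are isomorphic. 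-/

import Mathlib

namespace OrderedGroups

/-- The function symbols `+, -, 0` of the language of ordered groups (written additively). -/
inductive OGroupFunc : ℕ → Type
  | add : OGroupFunc 2
  | neg : OGroupFunc 1
  | zero : OGroupFunc 0

/-- The relation symbol `≤` of the language of ordered groups. -/
inductive OGroupRel : ℕ → Type
  | le : OGroupRel 2

/-- The first-order language `{+, -, 0, ≤}` of (totally) ordered groups. -/
def ogroupLang : FirstOrder.Language.{0, 0} := ⟨OGroupFunc, OGroupRel⟩

/-- An ordered group as a structure for the language of ordered groups. -/
instance ogroupStructure (G : Type*) [AddGroup G] [LE G] : ogroupLang.Structure G where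
  funMap := fun f x =>
    match f, x with
    | OGroupFunc.add, x => x 0 + x 1
    | OGroupFunc.neg, x => -x 0
    | OGroupFunc.zero, _ => 0
  RelMap := fun r x =>
    match r, x with
    | OGroupRel.le, x => x 0 ≤ x 1

/-- The function symbols `+, -, 0, ∨, ∧` of the language of lattice-ordered groups. -/
inductive LGroupFunc : ℕ → Type
  | add : LGroupFunc 2
  | neg : LGroupFunc 1
  | zero : LGroupFunc 0
  | sup : LGroupFunc 2
  | inf : LGroupFunc 2

/-- The first-order language `{+, -, 0, ∨, ∧}` of lattice-ordered groups; it has no relation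
symbol besides equality. -/
def lgroupLang : FirstOrder.Language.{0, 0} := ⟨LGroupFunc, fun _ => Empty⟩

/-- A lattice-ordered group as a structure for the language of lattice-ordered groups. -/
instance lgroupStructure (G : Type*) [AddGroup G] [Lattice G] : lgroupLang.Structure G where
  funMap := fun f x =>
    match f, x with
    | LGroupFunc.add, x => x 0 + x 1
    | LGroupFunc.neg, x => -x 0
    | LGroupFunc.zero, _ => 0
    | LGroupFunc.sup, x => x 0 ⊔ x 1
    | LGroupFunc.inf, x => x 0 ⊓ x 1
  RelMap := fun r _ => r.elim

/-- The subgroup `D(ξ) = ℤ + ℤξ` of `ℝ`. Its elements carry the order inherited from `ℝ`. -/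
def D (ξ : ℝ) : AddSubgroup ℝ where
  carrier := {x | ∃ m n : ℤ, x = m + n * ξ}
  zero_mem' := ⟨0, 0, by simp⟩
  add_mem' := by
    rintro _ _ ⟨m, n, rfl⟩ ⟨k, l, rfl⟩
    exact ⟨m + k, n + l, by push_cast; ring⟩
  neg_mem' := by
    rintro _ ⟨m, n, rfl⟩
    exact ⟨-m, -n, by push_cast; ring⟩

end OrderedGroups

/-!
Let `e : G ≃+ H` be an isomorphism of groups, not assumed to respect the orders of the totally
ordered abelian groups `G` and `H`. Compare a tuple `x` in `G` with a tuple `y` in `H` at level `N`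
by asking that integer combinations with coefficients up to `N` have the same signs at `x` and `y`,
and that `y` be congruent to `e x` modulo `N!`. If `n • H` is dense in `H` for all `n ≠ 0`, then
tuples that agree at a high level can be prolonged: the signs required of a new entry `q` either
prescribe a multiple of `q`, which is solvable because of the congruence, or confine a multiple of
`q` to an open interval, which meets every coset of every `n • H`. Terms are piecewise linear, so
atomic formulas see only the signs, and no formula distinguishes tuples that agree at a high enough
level. This applies to all `D ξ` at once, since they are isomorphic to `ℤ × ℤ` as groups and dense
in `ℝ`.

In contrast, an order-preserving homomorphism between subgroups of `ℝ` is a scaling. Hence an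
isomorphism `D ξ ≃+o D η` exhibits `ξ` as a quotient of two elements of the countable set `D η`,
each isomorphism class is countable, and there are uncountably many of them.
-/

namespace OrderedGroups

open FirstOrder FirstOrder.Language
open scoped Nat
open Fintype (linearCombination)
open SignType (sign)

section RegularlyDense

/-- A totally ordered abelian group `G` is regularly dense (Robinson and Zakon) if `n • G` is dense
in the order of `G` for every `n ≠ 0`. -/
def RegularlyDense (G : Type*) [AddMonoid G] [LT G] : Prop :=
  ∀ n : ℕ, n ≠ 0 → ∀ a b : G, a < b → ∃ z : G, a < n • z ∧ n • z < b

variable {G : Type*} [AddCommGroup G] [LinearOrder G]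

theorem RegularlyDense.denselyOrdered (hG : RegularlyDense G) : DenselyOrdered G where
  dense a b hab := by
    obtain ⟨z, haz, hzb⟩ := hG 1 one_ne_zero a b hab
    exact ⟨1 • z, haz, hzb⟩

theorem RegularlyDense.exists_add_nsmul_between [IsOrderedAddMonoid G] [Nontrivial G]
    (hG : RegularlyDense G) {n : ℕ} (hn : n ≠ 0) (g : G) {s t : Set G} (hs : s.Finite)
    (ht : t.Finite) (hst : ∀ a ∈ s, ∀ b ∈ t, a < b) :
    ∃ z : G, (∀ a ∈ s, a < g + n • z) ∧ ∀ b ∈ t, g + n • z < b := by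
  have := hG.denselyOrdered
  obtain ⟨l, hsl, hlt⟩ := Set.Finite.exists_between' hs ht hst
  obtain ⟨u, hlu, hut⟩ :=
    Set.Finite.exists_between' (Set.finite_singleton l) ht (by simpa using hlt)
  obtain ⟨z, hlz, hzu⟩ := hG n hn (l - g) (u - g) (by simpa using hlu)
  exact ⟨z, fun a ha => (hsl a ha).trans (sub_lt_iff_lt_add'.1 hlz),
    fun b hb => (lt_sub_iff_add_lt'.1 hzu).trans (hut b hb)⟩

theorem regularlyDense_of_dense {S : AddSubgroup ℝ} (hS : Dense (S : Set ℝ)) :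
    RegularlyDense S := by
  intro n hn a b hab
  have hn' : (0 : ℝ) < n := by positivity
  obtain ⟨z, hzS, haz, hzb⟩ :=
    hS.exists_between (div_lt_div_of_pos_right (Subtype.coe_lt_coe.2 hab) hn')
  refine ⟨⟨z, hzS⟩, ?_, ?_⟩
  · simpa [← Subtype.coe_lt_coe, div_lt_iff₀' hn'] using haz
  · simpa [← Subtype.coe_lt_coe, lt_div_iff₀' hn'] using hzb

end RegularlyDense

section Similar

theorem sign_zsmul {G : Type*} [AddCommGroup G] [LinearOrder G] [IsOrderedAddMonoid G]
    (k : ℤ) (a : G) : sign (k • a) = sign k * sign a := by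
  rcases lt_trichotomy k 0 with hk | rfl | hk
  · rcases lt_trichotomy a 0 with ha | rfl | ha
    · rw [sign_neg hk, sign_neg ha, sign_pos (smul_pos_of_neg_of_neg hk ha)]; rfl
    · simp
    · rw [sign_neg hk, sign_pos ha, sign_neg (smul_neg_of_neg_of_pos hk ha)]; rfl
  · simp
  · rcases lt_trichotomy a 0 with ha | rfl | ha
    · rw [sign_pos hk, sign_neg ha, sign_neg (smul_neg_of_pos_of_neg hk ha)]; rfl
    · simp
    · rw [sign_pos hk, sign_pos ha, sign_pos (smul_pos hk ha)]; rfl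

theorem linearCombination_snoc {G : Type*} [AddCommGroup G] {n : ℕ} (x : Fin n → G) (p : G)
    (c : Fin (n + 1) → ℤ) :
    linearCombination ℤ (Fin.snoc x p : Fin (n + 1) → G) c =
      linearCombination ℤ x (Fin.init c) + c (Fin.last n) • p := by
  simp [Fintype.linearCombination_apply, Fin.sum_univ_castSucc, Fin.init]

theorem norm_init_le {n : ℕ} (c : Fin (n + 1) → ℤ) : ‖(Fin.init c : Fin n → ℤ)‖ ≤ ‖c‖ :=
  (pi_norm_le_iff_of_nonneg (norm_nonneg c)).2 fun i => norm_le_pi_norm c i.castSucc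

variable {ι κ G H : Type*} [Fintype ι] [AddCommGroup G] [AddCommGroup H]

theorem linearCombination_linearCombination [Fintype κ] (x : ι → G) (C : κ → ι → ℤ) (c : κ → ℤ) :
    linearCombination ℤ (fun j => linearCombination ℤ x (C j)) c =
      linearCombination ℤ x (linearCombination ℤ C c) := by
  simp only [Fintype.linearCombination_apply, map_sum, map_smul]

theorem norm_linearCombination_le [Fintype κ] {K N : ℕ} {C : κ → ι → ℤ} {c : κ → ℤ}
    (hc : ‖c‖ ≤ K) (hC : ∀ j, ‖C j‖ ≤ N) :
    ‖linearCombination ℤ C c‖ ≤ (Fintype.card κ * (K * N) : ℕ) := by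
  have hterm (j : κ) : ‖c j • C j‖ ≤ K * N :=
    (norm_smul_le _ _).trans <|
      mul_le_mul ((norm_le_pi_norm c j).trans hc) (hC j) (norm_nonneg _) (by positivity)
  rw [Fintype.linearCombination_apply]
  exact (norm_sum_le_of_le _ fun j _ => hterm j).trans_eq (by simp)

/-- The tuple `y` is congruent modulo `M` to the image of `x` under `e`. -/
def CongrMod (e : G ≃+ H) (M : ℕ) (x : κ → G) (y : κ → H) : Prop :=
  ∀ i, ∃ z : H, y i = e (x i) + M • z

theorem CongrMod.of_dvd {e : G ≃+ H} {M M' : ℕ} {x : κ → G} {y : κ → H} (h : CongrMod e M x y)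
    (hM : M' ∣ M) : CongrMod e M' x y := by
  obtain ⟨k, rfl⟩ := hM
  intro i
  obtain ⟨z, hz⟩ := h i
  exact ⟨k • z, by rw [hz, mul_smul]⟩

theorem CongrMod.symm {e : G ≃+ H} {M : ℕ} {x : κ → G} {y : κ → H} (h : CongrMod e M x y) :
    CongrMod e.symm M y x := by
  intro i
  obtain ⟨z, hz⟩ := h i
  exact ⟨-e.symm z, by simp [hz]⟩

theorem CongrMod.snoc {e : G ≃+ H} {M n : ℕ} {x : Fin n → G} {y : Fin n → H}
    (h : CongrMod e M x y) (p : G) (z : H) :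
    CongrMod e M (Fin.snoc x p : Fin (n + 1) → G) (Fin.snoc y (e p + M • z) : Fin (n + 1) → H) :=
  Fin.lastCases ⟨z, by simp⟩ fun i => by simpa using h i

theorem CongrMod.exists_linearCombination_eq {e : G ≃+ H} {M : ℕ} {x : ι → G} {y : ι → H}
    (h : CongrMod e M x y) (c : ι → ℤ) :
    ∃ z : H, linearCombination ℤ y c = e (linearCombination ℤ x c) + M • z := by
  choose z hz using h
  refine ⟨linearCombination ℤ z c, ?_⟩
  simp only [Fintype.linearCombination_apply, hz, map_sum, map_zsmul, smul_add,
    Finset.sum_add_distrib, Finset.smul_sum, smul_comm M]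

variable [LinearOrder G] [LinearOrder H]

/-- For each integer vector `c` with entries bounded by `N` (the norm on `ι → ℤ` is the sup norm)
the combinations `∑ i, c i • x i` and `∑ i, c i • y i` have the same sign. -/
def SameSigns (N : ℕ) (x : ι → G) (y : ι → H) : Prop :=
  ∀ c : ι → ℤ, ‖c‖ ≤ N → sign (linearCombination ℤ x c) = sign (linearCombination ℤ y c)

theorem SameSigns.mono {N N' : ℕ} {x : ι → G} {y : ι → H} (h : SameSigns N x y) (hN : N' ≤ N) :
    SameSigns N' x y :=
  fun c hc => h c (hc.trans (mod_cast hN))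

theorem SameSigns.symm {N : ℕ} {x : ι → G} {y : ι → H} (h : SameSigns N x y) :
    SameSigns N y x :=
  fun c hc => (h c hc).symm

theorem SameSigns.sign_sub_eq {A B : ℕ} {x : ι → G} {y : ι → H} (h : SameSigns (A + B) x y)
    {c d : ι → ℤ} (hc : ‖c‖ ≤ A) (hd : ‖d‖ ≤ B) :
    sign (linearCombination ℤ x c - linearCombination ℤ x d) =
      sign (linearCombination ℤ y c - linearCombination ℤ y d) := by
  rw [← map_sub, ← map_sub]
  exact h _ ((norm_sub_le c d).trans (by push_cast; gcongr))

theorem SameSigns.le_iff [IsOrderedAddMonoid G] [IsOrderedAddMonoid H] {x : ι → G} {y : ι → H}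
    (h : SameSigns 2 x y) (i j : ι) : x i ≤ x j ↔ y i ≤ y j := by
  classical
  have hsign := h.sign_sub_eq (A := 1) (B := 1) (c := Pi.single i 1) (d := Pi.single j 1)
    (by simp [Pi.norm_single]) (by simp [Pi.norm_single])
  simp only [Fintype.linearCombination_apply_single, one_smul] at hsign
  rw [← sub_nonpos, ← sign_nonpos_iff, hsign, sign_nonpos_iff, sub_nonpos]

theorem SameSigns.eq_iff [IsOrderedAddMonoid G] [IsOrderedAddMonoid H] {x : ι → G} {y : ι → H}
    (h : SameSigns 2 x y) (i j : ι) : x i = x j ↔ y i = y j := by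
  rw [le_antisymm_iff, le_antisymm_iff, h.le_iff, h.le_iff]

theorem SameSigns.comp_linearCombination [Fintype κ] {K N : ℕ} {x : ι → G} {y : ι → H}
    (h : SameSigns (Fintype.card κ * (K * N)) x y) {C : κ → ι → ℤ} (hC : ∀ j, ‖C j‖ ≤ N) :
    SameSigns K (fun j => linearCombination ℤ x (C j)) fun j => linearCombination ℤ y (C j) := by
  intro c hc
  rw [linearCombination_linearCombination, linearCombination_linearCombination]
  exact h _ (norm_linearCombination_le hc hC)

section Extension

variable {e : G ≃+ H} {x : ι → G} {y : ι → H} {B K M : ℕ} {p : G}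

theorem SameSigns.exists_sign_eq_of_dependent (h : SameSigns (B + B) x y)
    (hc : CongrMod e (K * M) x y) {d₀ : ι → ℤ} (hd₀ : ‖d₀‖ ≤ B)
    (hp : linearCombination ℤ x d₀ + K • p = 0) :
    ∃ z : H, ∀ d : ι → ℤ, ‖d‖ ≤ B → sign (linearCombination ℤ x d + K • p) =
      sign (linearCombination ℤ y d + K • (e p + M • z)) := by
  obtain ⟨w, hw⟩ := hc.exists_linearCombination_eq d₀
  have hq : linearCombination ℤ y d₀ + K • (e p + M • -w) = 0 := by
    rw [hw, eq_neg_of_add_eq_zero_left hp, map_neg, map_nsmul, mul_smul]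
    module
  refine ⟨-w, fun d hd => ?_⟩
  rw [eq_neg_of_add_eq_zero_right hp, eq_neg_of_add_eq_zero_right hq, ← sub_eq_add_neg,
    ← sub_eq_add_neg]
  exact h.sign_sub_eq hd hd₀

theorem SameSigns.exists_sign_eq_of_independent [IsOrderedAddMonoid G]
    [IsOrderedAddMonoid H] [Nontrivial H] (hH : RegularlyDense H) (hK : K ≠ 0) (hM : M ≠ 0)
    (h : SameSigns (B + B) x y)
    (hp : ∀ d : ι → ℤ, ‖d‖ ≤ B → linearCombination ℤ x d + K • p ≠ 0) :
    ∃ z : H, ∀ d : ι → ℤ, ‖d‖ ≤ B → sign (linearCombination ℤ x d + K • p) =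
      sign (linearCombination ℤ y d + K • (e p + M • z)) := by
  let cut (σ : SignType) : Set (ι → ℤ) :=
    {d | ‖d‖ ≤ B ∧ sign (linearCombination ℤ x d + K • p) = σ}
  have cut_finite (σ : SignType) : (cut σ).Finite :=
    (isCompact_closedBall (0 : ι → ℤ) B).finite_of_discrete.subset fun d hd => by
      simpa using hd.1
  let b (d : ι → ℤ) : H := -linearCombination ℤ y d
  have b_lt_b : ∀ a ∈ b '' cut 1, ∀ a' ∈ b '' cut (-1), a < a' := by
    rintro _ ⟨d, ⟨hd, hpos⟩, rfl⟩ _ ⟨d', ⟨hd', hneg⟩, rfl⟩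
    have hlt : linearCombination ℤ x d' - linearCombination ℤ x d < 0 := by
      rw [sub_neg]
      exact lt_of_add_lt_add_right
        ((sign_eq_neg_one_iff.1 hneg).trans (sign_eq_one_iff.1 hpos))
    rw [← sign_eq_neg_one_iff, h.sign_sub_eq hd' hd, sign_eq_neg_one_iff, sub_neg] at hlt
    exact neg_lt_neg hlt
  obtain ⟨z, hlo, hhi⟩ := hH.exists_add_nsmul_between (mul_ne_zero hK hM) (K • e p)
    ((cut_finite 1).image b) ((cut_finite (-1)).image b) b_lt_b
  simp only [mul_smul, ← smul_add] at hlo hhi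
  refine ⟨z, fun d hd => ?_⟩
  rcases (hp d hd).lt_or_gt with hneg | hpos
  · have := hhi _ ⟨d, ⟨hd, sign_neg hneg⟩, rfl⟩
    rw [sign_neg hneg, sign_neg (lt_neg_iff_add_neg'.1 this)]
  · have := hlo _ ⟨d, ⟨hd, sign_pos hpos⟩, rfl⟩
    rw [sign_pos hpos, sign_pos (neg_lt_iff_pos_add'.1 this)]

end Extension

theorem exists_mul_eq_factorial {N : ℕ} {k : ℤ} (hk : k ≠ 0) (hkN : ‖k‖ ≤ N) :
    ∃ m : ℤ, m ≠ 0 ∧ ‖m‖ ≤ N ! ∧ m * k = N ! := by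
  rw [Int.norm_eq_abs, ← Int.cast_abs, Int.abs_eq_natAbs] at hkN
  have hdvd : k ∣ (N ! : ℤ) := Int.natAbs_dvd.1 <| Int.natCast_dvd_natCast.2 <|
    Nat.dvd_factorial (Int.natAbs_pos.2 hk) (mod_cast hkN)
  obtain ⟨m, hm⟩ := hdvd
  have hfact : (N ! : ℤ) ≠ 0 := mod_cast N.factorial_ne_zero
  have hm_le : |m| ≤ N ! :=
    Int.le_of_dvd (by positivity) ((abs_dvd _ _).2 (hm ▸ dvd_mul_left m k))
  refine ⟨m, right_ne_zero_of_mul (hm ▸ hfact), ?_, by rw [hm, mul_comm]⟩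
  rw [Int.norm_eq_abs]
  exact_mod_cast hm_le

theorem SameSigns.snoc [IsOrderedAddMonoid G] [IsOrderedAddMonoid H] {N n : ℕ} {x : Fin n → G}
    {y : Fin n → H} (h : SameSigns N x y) {p : G} {q : H}
    (hpq : ∀ d : Fin n → ℤ, ‖d‖ ≤ (N ! * N : ℕ) →
      sign (linearCombination ℤ x d + N ! • p) =
        sign (linearCombination ℤ y d + N ! • q)) :
    SameSigns N (Fin.snoc x p : Fin (n + 1) → G) (Fin.snoc y q : Fin (n + 1) → H) := by
  intro c hc
  rw [linearCombination_snoc, linearCombination_snoc]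
  have hinit : ‖(Fin.init c : Fin n → ℤ)‖ ≤ N := (norm_init_le c).trans hc
  rcases eq_or_ne (c (Fin.last n)) 0 with hk | hk
  · simpa only [hk, zero_smul, add_zero] using h _ hinit
  -- Scaling `c` by `m` turns its last entry into `N !`, whatever that entry is.
  obtain ⟨m, hm, hmN, hmul⟩ := exists_mul_eq_factorial hk ((norm_le_pi_norm c _).trans hc)
  have hbound : ‖m • (Fin.init c : Fin n → ℤ)‖ ≤ (N ! * N : ℕ) :=
    (norm_smul_le _ _).trans (by push_cast; gcongr)
  have := hpq _ hbound
  simp only [map_smul, ← natCast_zsmul, ← hmul, mul_smul, ← smul_add, sign_zsmul] at this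
  exact mul_left_cancel₀ (sign_ne_zero.2 hm) this

/-- The back-and-forth relation. A given formula does not distinguish `N`-similar tuples
once `N` is large enough. -/
structure Similar (e : G ≃+ H) (N : ℕ) (x : ι → G) (y : ι → H) : Prop where
  sameSigns : SameSigns N x y
  congrMod : CongrMod e (N !) x y

theorem Similar.mono {e : G ≃+ H} {N N' : ℕ} {x : ι → G} {y : ι → H} (h : Similar e N x y)
    (hN : N' ≤ N) : Similar e N' x y :=
  ⟨h.sameSigns.mono hN, h.congrMod.of_dvd (Nat.factorial_dvd_factorial hN)⟩

theorem Similar.symm {e : G ≃+ H} {N : ℕ} {x : ι → G} {y : ι → H} (h : Similar e N x y) :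
    Similar e.symm N y x :=
  ⟨h.sameSigns.symm, h.congrMod.symm⟩

theorem similar_of_isEmpty [IsEmpty ι] (e : G ≃+ H) (N : ℕ) (x : ι → G) (y : ι → H) :
    Similar e N x y :=
  ⟨fun c _ => by simp [Fintype.linearCombination_apply], isEmptyElim⟩

theorem Similar.exists_snoc [IsOrderedAddMonoid G] [IsOrderedAddMonoid H] [Nontrivial H]
    (hH : RegularlyDense H) {e : G ≃+ H} {N n : ℕ} {x : Fin n → G} {y : Fin n → H}
    (h : Similar e (N ! * N + N ! * N) x y) (p : G) :
    ∃ q : H, Similar e N (Fin.snoc x p : Fin (n + 1) → G) (Fin.snoc y q : Fin (n + 1) → H) := by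
  have hN : N ≤ N ! * N := Nat.le_mul_of_pos_left N N.factorial_pos
  have hfact : N ! ≠ 0 := N.factorial_ne_zero
  have hcongr : CongrMod e (N ! * N !) x y := h.congrMod.of_dvd <|
    (Nat.factorial_mul_factorial_dvd_factorial_add N N).trans
      (Nat.factorial_dvd_factorial (Nat.add_le_add hN hN))
  have hz : ∃ z : H, ∀ d : Fin n → ℤ, ‖d‖ ≤ (N ! * N : ℕ) →
      sign (linearCombination ℤ x d + N ! • p) =
        sign (linearCombination ℤ y d + N ! • (e p + N ! • z)) := by
    by_cases hp : ∃ d₀ : Fin n → ℤ, ‖d₀‖ ≤ (N ! * N : ℕ) ∧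
        linearCombination ℤ x d₀ + N ! • p = 0
    · obtain ⟨d₀, hd₀, hp⟩ := hp
      exact h.sameSigns.exists_sign_eq_of_dependent hcongr hd₀ hp
    · exact h.sameSigns.exists_sign_eq_of_independent hH hfact hfact fun d hd h0 => hp ⟨d, hd, h0⟩
  obtain ⟨z, hz⟩ := hz
  exact ⟨e p + N ! • z, (h.sameSigns.mono (hN.trans (Nat.le_add_right _ _))).snoc hz,
    (hcongr.of_dvd (dvd_mul_right _ _)).snoc p z⟩

end Similar

section PiecewiseLinear

variable {ι κ α G H : Type*} [Fintype ι] [Fintype κ] [Fintype α]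
  [AddCommGroup G] [LinearOrder G] [AddCommGroup H] [LinearOrder H]

/-- On tuples `x` and `y` with the same signs up to `N`, the functions `f` and `g` are given by one
and the same integer combination, with coefficients bounded by `N`. This holds for the
interpretations in `G` and `H` of a term built from `+`, `-`, `0`, `⊔` and `⊓`. -/
def SameLinearPieces (N : ℕ) (f : (ι → G) → G) (g : (ι → H) → H) : Prop :=
  ∀ x y, SameSigns N x y →
    ∃ c : ι → ℤ, ‖c‖ ≤ N ∧ f x = linearCombination ℤ x c ∧ g y = linearCombination ℤ y c

theorem SameLinearPieces.mono {N N' : ℕ} {f : (ι → G) → G} {g : (ι → H) → H}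
    (h : SameLinearPieces N f g) (hN : N ≤ N') : SameLinearPieces N' f g := by
  intro x y hxy
  obtain ⟨c, hc, hf, hg⟩ := h x y (hxy.mono hN)
  exact ⟨c, hc.trans (mod_cast hN), hf, hg⟩

theorem sameLinearPieces_apply (i : ι) :
    SameLinearPieces 1 (fun x : ι → G => x i) (fun y : ι → H => y i) := by
  classical
  exact fun x y _ => ⟨Pi.single i 1, by simp [Pi.norm_single]⟩

theorem sameLinearPieces_zero :
    SameLinearPieces 0 (fun _ : ι → G => 0) (fun _ : ι → H => 0) :=
  fun _ _ _ => ⟨0, by simp⟩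

theorem sameLinearPieces_neg (i : ι) :
    SameLinearPieces 1 (fun x : ι → G => -x i) (fun y : ι → H => -y i) := by
  classical
  exact fun x y _ => ⟨-Pi.single i 1, by simp [Pi.norm_single]⟩

theorem sameLinearPieces_add (i j : ι) :
    SameLinearPieces 2 (fun x : ι → G => x i + x j) (fun y : ι → H => y i + y j) := by
  classical
  refine fun x y _ => ⟨Pi.single i 1 + Pi.single j 1, ?_, by simp, by simp⟩
  refine (norm_add_le _ _).trans ?_
  norm_num [Pi.norm_single]

theorem sameLinearPieces_of_le_cases [IsOrderedAddMonoid G] [IsOrderedAddMonoid H]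
    {f : (ι → G) → G} {g : (ι → H) → H} {i j k l : ι}
    (hf : ∀ x, x i ≤ x j → f x = x k) (hf' : ∀ x, x j ≤ x i → f x = x l)
    (hg : ∀ y, y i ≤ y j → g y = y k) (hg' : ∀ y, y j ≤ y i → g y = y l) :
    SameLinearPieces 2 f g := by
  intro x y h
  rcases le_total (x i) (x j) with hx | hx
  · rw [hf x hx, hg y ((h.le_iff i j).1 hx)]
    exact (sameLinearPieces_apply k).mono one_le_two x y h
  · rw [hf' x hx, hg' y ((h.le_iff j i).1 hx)]
    exact (sameLinearPieces_apply l).mono one_le_two x y h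

theorem sameLinearPieces_sup [IsOrderedAddMonoid G] [IsOrderedAddMonoid H] (i j : ι) :
    SameLinearPieces 2 (fun x : ι → G => x i ⊔ x j) (fun y : ι → H => y i ⊔ y j) :=
  sameLinearPieces_of_le_cases (fun _ => sup_of_le_right) (fun _ => sup_of_le_left)
    (fun _ => sup_of_le_right) (fun _ => sup_of_le_left)

theorem sameLinearPieces_inf [IsOrderedAddMonoid G] [IsOrderedAddMonoid H] (i j : ι) :
    SameLinearPieces 2 (fun x : ι → G => x i ⊓ x j) (fun y : ι → H => y i ⊓ y j) :=
  sameLinearPieces_of_le_cases (fun _ => inf_of_le_left) (fun _ => inf_of_le_right)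
    (fun _ => inf_of_le_left) (fun _ => inf_of_le_right)

theorem exists_forall_sameLinearPieces {β : Type*} [Finite β] {f : β → (ι → G) → G}
    {g : β → (ι → H) → H} (h : ∀ j, ∃ N, SameLinearPieces N (f j) (g j)) :
    ∃ N, ∀ j, SameLinearPieces N (f j) (g j) := by
  cases nonempty_fintype β
  choose N hN using h
  exact ⟨Finset.univ.sup N, fun j => (hN j).mono (Finset.le_sup (Finset.mem_univ j))⟩

theorem SameSigns.exists_linearCombination_eq {N K : ℕ} {f : κ → (ι → G) → G} {g : κ → (ι → H) → H}
    (h : ∀ j, SameLinearPieces N (f j) (g j)) {x : ι → G} {y : ι → H}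
    (hxy : SameSigns (N + Fintype.card κ * (K * N)) x y) :
    ∃ C : κ → ι → ℤ, (∀ j, ‖C j‖ ≤ N) ∧
      (fun j => f j x) = (fun j => linearCombination ℤ x (C j)) ∧
      (fun j => g j y) = (fun j => linearCombination ℤ y (C j)) ∧
      SameSigns K (fun j => f j x) (fun j => g j y) := by
  choose C hC hf hg using fun j => h j x y (hxy.mono (Nat.le_add_right _ _))
  refine ⟨C, hC, funext hf, funext hg, ?_⟩
  rw [funext hf, funext hg]
  exact (hxy.mono (Nat.le_add_left _ _)).comp_linearCombination hC

theorem SameLinearPieces.comp {N K : ℕ} {F : (κ → G) → G} {F' : (κ → H) → H}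
    (hF : SameLinearPieces K F F') {f : κ → (ι → G) → G} {g : κ → (ι → H) → H}
    (h : ∀ j, SameLinearPieces N (f j) (g j)) :
    SameLinearPieces (N + Fintype.card κ * (K * N)) (fun x => F fun j => f j x)
      fun y => F' fun j => g j y := by
  intro x y hxy
  obtain ⟨C, hC, hf, hg, hfg⟩ := hxy.exists_linearCombination_eq h
  obtain ⟨c, hc, hFc, hFc'⟩ := hF _ _ hfg
  refine ⟨linearCombination ℤ C c, ?_, ?_, ?_⟩
  · exact (norm_linearCombination_le hc hC).trans (mod_cast Nat.le_add_left _ _)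
  · exact hFc.trans (by rw [hf, linearCombination_linearCombination])
  · exact hFc'.trans (by rw [hg, linearCombination_linearCombination])

/-- The function symbols of `L` are interpreted in `G` and `H` by functions with the same linear
pieces, and the relation symbols by relations that depend only on the signs of bounded integer
combinations. -/
structure IsPiecewiseLinear (L : Language) (G H : Type*) [AddCommGroup G] [LinearOrder G]
    [AddCommGroup H] [LinearOrder H] [L.Structure G] [L.Structure H] : Prop where
  exists_sameLinearPieces_funMap {l : ℕ} (f : L.Functions l) :
    ∃ N : ℕ, SameLinearPieces N (Structure.funMap f : (Fin l → G) → G)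
      (Structure.funMap f : (Fin l → H) → H)
  exists_relMap_iff {l : ℕ} (R : L.Relations l) : ∃ N : ℕ, ∀ (x : Fin l → G)
    (y : Fin l → H), SameSigns N x y → (Structure.RelMap R x ↔ Structure.RelMap R y)

variable {L : Language} [L.Structure G] [L.Structure H]

theorem IsPiecewiseLinear.exists_sameLinearPieces_realize (hL : IsPiecewiseLinear L G H)
    (t : L.Term α) :
    ∃ N, SameLinearPieces N (fun x : α → G => t.realize x) fun y : α → H => t.realize y := by
  induction t with
  | var a => exact ⟨1, sameLinearPieces_apply a⟩
  | func f ts ih =>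
    obtain ⟨K, hf⟩ := hL.exists_sameLinearPieces_funMap f
    obtain ⟨N, hts⟩ := exists_forall_sameLinearPieces ih
    exact ⟨_, hf.comp hts⟩

theorem IsPiecewiseLinear.exists_sameSigns_realize (hL : IsPiecewiseLinear L G H) (K : ℕ)
    (ts : κ → L.Term α) :
    ∃ N, ∀ (x : α → G) (y : α → H), SameSigns N x y →
      SameSigns K (fun j => (ts j).realize x) fun j => (ts j).realize y := by
  obtain ⟨N, hts⟩ := exists_forall_sameLinearPieces
    fun j => hL.exists_sameLinearPieces_realize (ts j)
  exact ⟨_, fun x y hxy => (hxy.exists_linearCombination_eq hts).choose_spec.2.2.2⟩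

theorem SameSigns.sumElim_of_isEmpty {N : ℕ} {x : ι → G} {y : ι → H} (h : SameSigns N x y)
    [IsEmpty α] (v : α → G) (w : α → H) : SameSigns N (Sum.elim v x) (Sum.elim w y) := by
  intro c hc
  have := h (c ∘ Sum.inr) <| (pi_norm_le_iff_of_nonneg (by positivity)).2
    fun i => (norm_le_pi_norm c (Sum.inr i)).trans hc
  simpa [Fintype.linearCombination_apply] using this

theorem IsPiecewiseLinear.exists_realize_iff [IsOrderedAddMonoid G] [IsOrderedAddMonoid H]
    [Nontrivial G] [Nontrivial H] (hL : IsPiecewiseLinear L G H) (hG : RegularlyDense G)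
    (hH : RegularlyDense H) (e : G ≃+ H) {n : ℕ} (θ : L.BoundedFormula Empty n) :
    ∃ N, ∀ (x : Fin n → G) (y : Fin n → H), Similar e N x y →
      (θ.Realize default x ↔ θ.Realize default y) := by
  induction θ with
  | falsum => exact ⟨0, fun _ _ _ => Iff.rfl⟩
  | equal t₁ t₂ =>
    obtain ⟨N, hN⟩ := hL.exists_sameSigns_realize 2 ![t₁, t₂]
    exact ⟨N, fun x y h => (hN _ _ (h.sameSigns.sumElim_of_isEmpty _ _)).eq_iff 0 1⟩
  | rel R ts =>
    obtain ⟨K, hR⟩ := hL.exists_relMap_iff R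
    obtain ⟨N, hN⟩ := hL.exists_sameSigns_realize K ts
    exact ⟨N, fun x y h => hR _ _ (hN _ _ (h.sameSigns.sumElim_of_isEmpty _ _))⟩
  | imp θ₁ θ₂ ih₁ ih₂ =>
    obtain ⟨N₁, h₁⟩ := ih₁
    obtain ⟨N₂, h₂⟩ := ih₂
    exact ⟨max N₁ N₂, fun x y h =>
      imp_congr (h₁ x y (h.mono (le_max_left _ _))) (h₂ x y (h.mono (le_max_right _ _)))⟩
  | all θ ih =>
    obtain ⟨N, hN⟩ := ih
    refine ⟨N ! * N + N ! * N, fun x y h => ⟨fun hθ q => ?_, fun hθ p => ?_⟩⟩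
    · obtain ⟨p, hp⟩ := h.symm.exists_snoc hG q
      exact (hN _ _ hp.symm).1 (hθ p)
    · obtain ⟨q, hq⟩ := h.exists_snoc hH p
      exact (hN _ _ hq).2 (hθ q)

theorem IsPiecewiseLinear.elementarilyEquivalent [IsOrderedAddMonoid G] [IsOrderedAddMonoid H]
    [Nontrivial G] (hL : IsPiecewiseLinear L G H) (hG : RegularlyDense G)
    (hH : RegularlyDense H) (e : G ≃+ H) : L.ElementarilyEquivalent G H := by
  have := e.symm.toEquiv.nontrivial
  refine elementarilyEquivalent_iff.2 fun θ => ?_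
  obtain ⟨N, hN⟩ := hL.exists_realize_iff hG hH e θ
  exact hN default default (similar_of_isEmpty e N _ _)

theorem isPiecewiseLinear_ogroupLang [IsOrderedAddMonoid G] [IsOrderedAddMonoid H] :
    IsPiecewiseLinear ogroupLang G H where
  exists_sameLinearPieces_funMap
    | .add => ⟨2, sameLinearPieces_add 0 1⟩
    | .neg => ⟨1, sameLinearPieces_neg 0⟩
    | .zero => ⟨0, sameLinearPieces_zero⟩
  exists_relMap_iff
    | .le => ⟨2, fun _ _ h => h.le_iff 0 1⟩

theorem isPiecewiseLinear_lgroupLang [IsOrderedAddMonoid G] [IsOrderedAddMonoid H] :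
    IsPiecewiseLinear lgroupLang G H where
  exists_sameLinearPieces_funMap
    | .add => ⟨2, sameLinearPieces_add 0 1⟩
    | .neg => ⟨1, sameLinearPieces_neg 0⟩
    | .zero => ⟨0, sameLinearPieces_zero⟩
    | .sup => ⟨2, sameLinearPieces_sup 0 1⟩
    | .inf => ⟨2, sameLinearPieces_inf 0 1⟩
  exists_relMap_iff R := R.elim

end PiecewiseLinear

section Subgroups

variable {ξ η : ℝ}

theorem one_mem_D (ξ : ℝ) : (1 : ℝ) ∈ D ξ := ⟨1, 0, by simp⟩

theorem self_mem_D (ξ : ℝ) : ξ ∈ D ξ := ⟨0, 1, by simp⟩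

instance : Nontrivial (D ξ) :=
  ⟨⟨⟨1, one_mem_D ξ⟩, 0, fun h => one_ne_zero (congrArg Subtype.val h)⟩⟩

theorem closure_pair_eq_D (ξ : ℝ) : AddSubgroup.closure {1, ξ} = D ξ := by
  ext x
  simp only [AddSubgroup.mem_closure_pair, zsmul_eq_mul, mul_one, eq_comm (b := x)]
  rfl

theorem dense_D (hξ : Irrational ξ) : Dense (D ξ : Set ℝ) := by
  rwa [← closure_pair_eq_D, Set.pair_comm, dense_addSubgroupClosure_pair_iff, div_one]

instance : AddGroup.FG (D ξ) :=
  (AddGroup.fg_iff_addSubgroup_fg _).2 ⟨{1, ξ}, by simpa using closure_pair_eq_D ξ⟩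

/-- The homomorphism `(m, n) ↦ m + n * ξ`, whose range is `D ξ`. -/
def ofCoords (ξ : ℝ) : ℤ × ℤ →+ ℝ where
  toFun p := p.1 + p.2 * ξ
  map_zero' := by simp
  map_add' p q := by push_cast [Prod.fst_add, Prod.snd_add]; ring

theorem range_ofCoords (ξ : ℝ) : (ofCoords ξ).range = D ξ := by
  ext x
  exact ⟨fun ⟨p, hp⟩ => ⟨p.1, p.2, hp.symm⟩, fun ⟨m, n, hx⟩ => ⟨(m, n), hx.symm⟩⟩

instance : Countable (D ξ) := by
  rw [← range_ofCoords]
  exact (Set.countable_range (ofCoords ξ)).to_subtype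

theorem ofCoords_injective (hξ : Irrational ξ) : Function.Injective (ofCoords ξ) := by
  refine (injective_iff_map_eq_zero _).2 fun ⟨m, n⟩ h => ?_
  change (m : ℝ) + n * ξ = 0 at h
  obtain rfl : n = 0 := by
    by_contra hn
    exact (hξ.intCast_mul hn).ne_int (-m) (by push_cast; linear_combination h)
  simpa using h

theorem existsUnique_coords (hξ : Irrational ξ) {x : ℝ} (hx : x ∈ D ξ) :
    ∃! p : ℤ × ℤ, x = p.1 + p.2 * ξ := by
  obtain ⟨m, n, rfl⟩ := hx
  exact ⟨(m, n), rfl, fun p hp => ofCoords_injective hξ hp.symm⟩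

theorem nonempty_addEquiv_D (hξ : Irrational ξ) (hη : Irrational η) : Nonempty (D ξ ≃+ D η) := by
  rw [← range_ofCoords, ← range_ofCoords]
  exact ⟨(AddMonoidHom.ofInjective (ofCoords_injective hξ)).symm.trans
    (AddMonoidHom.ofInjective (ofCoords_injective hη))⟩

theorem elementarilyEquivalent_D (hξ : Irrational ξ) (hη : Irrational η) {L : Language}
    [L.Structure (D ξ)] [L.Structure (D η)] (hL : IsPiecewiseLinear L (D ξ) (D η)) :
    L.ElementarilyEquivalent (D ξ) (D η) :=
  let ⟨e⟩ := nonempty_addEquiv_D hξ hη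
  hL.elementarilyEquivalent (regularlyDense_of_dense (dense_D hξ))
    (regularlyDense_of_dense (dense_D hη)) e

end Subgroups

section Isomorphisms

section Scaling

variable {G K : Type*} [AddCommGroup G] [LinearOrder G] [IsOrderedAddMonoid G] [Archimedean G]
  [CommRing K] [LinearOrder K] [IsStrictOrderedRing K] [Archimedean K] {f g : G →+ K}

theorem map_mul_map_le_of_monotone (hf : Monotone f) (hg : Monotone g) (a : G) {b : G}
    (hb : 0 < b) : f a * g b ≤ g a * f b := by
  have hfb : 0 ≤ f b := by simpa using hf hb.le
  have hgb : 0 ≤ g b := by simpa using hg hb.le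
  have hbound (m : ℕ) : m • (f a * g b - g a * f b) ≤ g b * f b := by
    obtain ⟨k, ⟨hk, hk'⟩, -⟩ := existsUnique_zsmul_near_of_pos hb (m • a)
    have hfa : m * f a ≤ (k + 1) * f b := by simpa using hf hk'.le
    have hga : k * g b ≤ m * g a := by simpa using hg hk
    rw [nsmul_eq_mul]
    linarith [mul_le_mul_of_nonneg_right hfa hgb, mul_le_mul_of_nonneg_right hga hfb]
  by_contra! hlt
  obtain ⟨m, hm⟩ := Archimedean.arch (g b * f b + 1) (sub_pos.2 hlt)
  linarith [hbound m]

theorem map_mul_map_eq_of_monotone (hf : Monotone f) (hg : Monotone g) (a : G) {b : G}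
    (hb : 0 < b) : f a * g b = g a * f b :=
  (map_mul_map_le_of_monotone hf hg a hb).antisymm (map_mul_map_le_of_monotone hg hf a hb)

end Scaling

theorem eq_map_div_map {ξ η : ℝ} (f : D ξ ≃+o D η) :
    ξ = f ⟨ξ, self_mem_D ξ⟩ / f ⟨1, one_mem_D ξ⟩ := by
  have hone : (0 : D ξ) < ⟨1, one_mem_D ξ⟩ := zero_lt_one (α := ℝ)
  have hpos : (0 : ℝ) < f ⟨1, one_mem_D ξ⟩ :=
    Subtype.coe_lt_coe.2 (by simpa using f.strictMono hone)
  have hscale := map_mul_map_eq_of_monotone (f := (D ξ).subtype)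
    (g := (D η).subtype.comp f.toAddEquiv.toAddMonoidHom) (Subtype.mono_coe _)
    (fun _ _ h => (map_le_map_iff f).2 h) ⟨ξ, self_mem_D ξ⟩ hone
  rw [eq_div_iff hpos.ne']
  simpa using hscale

theorem countable_setOf_nonempty_orderAddMonoidIso (η : ℝ) :
    {ξ : ℝ | Nonempty (D ξ ≃+o D η)}.Countable :=
  (Set.countable_range fun p : D η × D η => (p.1 / p.2 : ℝ)).mono
    fun _ ⟨f⟩ => Set.mem_range.2 ⟨(f _, f _), (eq_map_div_map f).symm⟩

/-- The irrational numbers up to isomorphism of the ordered groups `D ξ`. -/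
def isoSetoid : Setoid {ξ : ℝ // Irrational ξ} where
  r ξ η := Nonempty (D ξ ≃+o D η)
  iseqv := ⟨fun _ => ⟨.refl _⟩, fun ⟨f⟩ => ⟨f.symm⟩, fun ⟨f⟩ ⟨g⟩ => ⟨f.trans g⟩⟩

theorem uncountable_irrational : Uncountable {ξ : ℝ // Irrational ξ} := by
  refine not_countable_iff.1 fun h => Set.not_countable_univ (α := ℝ) ?_
  have hirr : {ξ : ℝ | Irrational ξ}.Countable := h
  exact (hirr.union (Set.countable_range ((↑) : ℚ → ℝ))).mono
    fun ξ _ => (em (Irrational ξ)).imp id not_not.1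

theorem uncountable_quotient {α : Type*} [Uncountable α] {s : Setoid α}
    (hs : ∀ a, {b | s b a}.Countable) : Uncountable (Quotient s) := by
  refine not_countable_iff.1 fun h => not_countable (α := α) ?_
  refine Set.Countable.of_preimage_singleton (f := Quotient.mk s) (Quotient.ind fun a => ?_)
  exact (hs a).mono fun b hb => Quotient.exact hb

theorem exists_uncountable_transversal {α : Type*} [Uncountable α] {s : Setoid α}
    (hs : ∀ a, {b | s b a}.Countable) :
    ∃ X : Set α, ¬ X.Countable ∧ (∀ a ∈ X, ∀ b ∈ X, s a b → a = b) ∧ ∀ a, ∃ b ∈ X, s a b := by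
  have := uncountable_quotient hs
  refine ⟨Set.range (Quotient.out : Quotient s → α), fun h => ?_, ?_, fun a => ?_⟩
  · have := h.to_subtype
    exact not_countable (Set.rangeFactorization_injective.2
      (Quotient.out_injective (s := s))).countable
  · rintro _ ⟨p, rfl⟩ _ ⟨q, rfl⟩ h
    rw [Quotient.out_equiv_out.1 h]
  · exact ⟨_, ⟨⟦a⟧, rfl⟩, s.symm (Quotient.mk_out a)⟩

theorem exists_transversal_D : ∃ X : Set ℝ, (∀ ξ ∈ X, Irrational ξ) ∧ ¬ X.Countable ∧
    (∀ ξ ∈ X, ∀ η ∈ X, ξ ≠ η → IsEmpty (D ξ ≃+o D η)) ∧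
    ∀ η : ℝ, Irrational η → ∃ ξ ∈ X, Nonempty (D η ≃+o D ξ) := by
  have := uncountable_irrational
  obtain ⟨X, hX, hinj, hsurj⟩ := exists_uncountable_transversal (s := isoSetoid) fun η =>
    (countable_setOf_nonempty_orderAddMonoidIso η).preimage Subtype.val_injective
  refine ⟨Subtype.val '' X, ?_, ?_, ?_, fun η hη => ?_⟩
  · rintro _ ⟨ξ, -, rfl⟩
    exact ξ.2
  · exact fun h => hX <|
      Set.countable_of_injective_of_countable_image Subtype.val_injective.injOn h
  · rintro _ ⟨ξ, hξ, rfl⟩ _ ⟨η, hη, rfl⟩ hne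
    exact not_nonempty_iff.1 fun h => hne (congrArg Subtype.val (hinj ξ hξ η hη h))
  · obtain ⟨ξ, hξ, h⟩ := hsurj ⟨η, hη⟩
    exact ⟨ξ, ⟨ξ, hξ, rfl⟩, h⟩

end Isomorphisms

section Languages

theorem nonempty_orderAddMonoidIso_of_lgroupEquiv {G H : Type*} [AddGroup G] [Lattice G]
    [AddGroup H] [Lattice H] (f : lgroupLang.Equiv G H) : Nonempty (G ≃+o H) := by
  have map_add (a b : G) : f (a + b) = f a + f b :=
    f.map_fun (LGroupFunc.add : lgroupLang.Functions 2) ![a, b]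
  have map_sup (a b : G) : f (a ⊔ b) = f a ⊔ f b :=
    f.map_fun (LGroupFunc.sup : lgroupLang.Functions 2) ![a, b]
  refine ⟨{ toEquiv := f.toEquiv, map_add' := map_add, map_le_map_iff' := fun {a b} => ?_ }⟩
  change f a ≤ f b ↔ a ≤ b
  rw [← sup_eq_right, ← map_sup, f.injective.eq_iff, sup_eq_right]

/-- An `ℓ`-subgroup, given as a substructure, regarded as a subgroup. -/
def addSubgroupOfSubstructure {G : Type*} [AddGroup G] [Lattice G]
    (S : lgroupLang.Substructure G) : AddSubgroup G where
  carrier := S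
  add_mem' {a b} ha hb := S.fun_mem (LGroupFunc.add : lgroupLang.Functions 2) ![a, b]
    (Fin.forall_fin_two.2 ⟨ha, hb⟩)
  zero_mem' := S.fun_mem (LGroupFunc.zero : lgroupLang.Functions 0) ![] isEmptyElim
  neg_mem' {a} ha := S.fun_mem (LGroupFunc.neg : lgroupLang.Functions 1) ![a]
    (Fin.forall_fin_one.2 ha)

theorem structureFG_lgroupLang (G : Type*) [AddGroup G] [Lattice G] [AddGroup.FG G] :
    Structure.FG lgroupLang G := by
  obtain ⟨s, hs, hfin⟩ := AddGroup.fg_iff.1 ‹AddGroup.FG G›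
  refine Structure.fg_iff.2 ⟨s, hfin, eq_top_iff.2 fun a _ => ?_⟩
  have hle : AddSubgroup.closure s ≤ addSubgroupOfSubstructure (Substructure.closure _ s) :=
    (AddSubgroup.closure_le _).2 Substructure.subset_closure
  exact hle (hs ▸ AddSubgroup.mem_top a)

instance (l : ℕ) : Countable (OGroupFunc l) :=
  Function.Injective.countable (f := OGroupFunc.ctorIdx) (by rintro ⟨⟩ ⟨⟩ _ <;> rfl)

instance (l : ℕ) : Countable (OGroupRel l) :=
  Function.Injective.countable (f := OGroupRel.ctorIdx) (by rintro ⟨⟩ ⟨⟩ _; rfl)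

instance (l : ℕ) : Countable (LGroupFunc l) :=
  Function.Injective.countable (f := LGroupFunc.ctorIdx)
    (by rintro ⟨⟩ ⟨⟩ h <;> first | rfl | cases h)

theorem countable_symbols_ogroupLang : Countable ogroupLang.Symbols :=
  inferInstanceAs (Countable ((Σ l, OGroupFunc l) ⊕ Σ l, OGroupRel l))

theorem countable_symbols_lgroupLang : Countable lgroupLang.Symbols :=
  inferInstanceAs (Countable ((Σ l, LGroupFunc l) ⊕ Σ _ : ℕ, Empty))

end Languages

end OrderedGroups

theorem mainTheorem3 :
    -- `D(ξ) = ℤ ⊕ ℤξ` is a two-generator, dense, totally ordered abelian group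
    (∀ ξ : ℝ, Irrational ξ →
      (∀ x ∈ OrderedGroups.D ξ, ∃! p : ℤ × ℤ, x = p.1 + p.2 * ξ) ∧
      AddSubgroup.closure {1, ξ} = OrderedGroups.D ξ ∧
      Dense (OrderedGroups.D ξ : Set ℝ) ∧
      DenselyOrdered (OrderedGroups.D ξ) ∧
      IsOrderedAddMonoid (OrderedGroups.D ξ)) ∧
    -- both languages are countable
    Countable OrderedGroups.ogroupLang.Symbols ∧
    Countable OrderedGroups.lgroupLang.Symbols ∧
    -- all `D(ξ)` are elementarily equivalent, as ordered groups and as lattice-ordered groups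
    (∀ ξ η : ℝ, Irrational ξ → Irrational η →
      OrderedGroups.ogroupLang.ElementarilyEquivalent
        (OrderedGroups.D ξ) (OrderedGroups.D η) ∧
      OrderedGroups.lgroupLang.ElementarilyEquivalent
        (OrderedGroups.D ξ) (OrderedGroups.D η)) ∧
    -- up to isomorphism, the `D(ξ)` form an uncountable family
    (∃ X : Set ℝ, (∀ ξ ∈ X, Irrational ξ) ∧ ¬ X.Countable ∧
      (∀ ξ ∈ X, ∀ η ∈ X, ξ ≠ η →
        IsEmpty (OrderedGroups.D ξ ≃+o OrderedGroups.D η) ∧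
        IsEmpty (OrderedGroups.lgroupLang.Equiv (OrderedGroups.D ξ) (OrderedGroups.D η))) ∧
      (∀ η : ℝ, Irrational η → ∃ ξ ∈ X,
        Nonempty (OrderedGroups.D η ≃+o OrderedGroups.D ξ))) ∧
    -- finitely generated, elementarily equivalent abelian lattice-ordered groups need not be
    -- isomorphic
    (¬ ∀ (G H : Type) [AddCommGroup G] [Lattice G] [IsOrderedAddMonoid G]
        [AddCommGroup H] [Lattice H] [IsOrderedAddMonoid H],
        FirstOrder.Language.Structure.FG OrderedGroups.lgroupLang G →
        FirstOrder.Language.Structure.FG OrderedGroups.lgroupLang H →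
        OrderedGroups.lgroupLang.ElementarilyEquivalent G H →
        Nonempty (OrderedGroups.lgroupLang.Equiv G H)) := by
  open OrderedGroups in
  have lgroup_equiv {ξ η : ℝ} (hξ : Irrational ξ) (hη : Irrational η) :=
    elementarilyEquivalent_D hξ hη isPiecewiseLinear_lgroupLang
  obtain ⟨X, hirr, hX, hiso, hrep⟩ := exists_transversal_D
  have hiso' : ∀ ξ ∈ X, ∀ η ∈ X, ξ ≠ η → IsEmpty (lgroupLang.Equiv (D ξ) (D η)) :=
    fun ξ hξ η hη hne => ⟨fun f =>
      (nonempty_orderAddMonoidIso_of_lgroupEquiv f).elim (hiso ξ hξ η hη hne).false⟩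
  obtain ⟨ξ, hξ, η, hη, hne⟩ : X.Nontrivial :=
    Set.not_subsingleton_iff.1 fun h => hX h.countable
  refine ⟨fun ξ hξ => ⟨fun x => existsUnique_coords hξ, closure_pair_eq_D ξ, dense_D hξ,
      (regularlyDense_of_dense (dense_D hξ)).denselyOrdered, inferInstance⟩,
    countable_symbols_ogroupLang, countable_symbols_lgroupLang,
    fun ξ η hξ hη => ⟨elementarilyEquivalent_D hξ hη isPiecewiseLinear_ogroupLang,
      lgroup_equiv hξ hη⟩,
    ⟨X, hirr, hX, fun ξ hξ η hη hne => ⟨hiso ξ hξ η hη hne, hiso' ξ hξ η hη hne⟩, hrep⟩,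
    fun h => ?_⟩
  obtain ⟨f⟩ := h (D ξ) (D η) (structureFG_lgroupLang _) (structureFG_lgroupLang _)
    (lgroup_equiv (hirr ξ hξ) (hirr η hη))
  exact (hiso' ξ hξ η hη hne).false f
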